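/- Let $(W,S)$ be a Coxeter system with $S$ finite, $n=|S|$, and Coxeter matrix $(m_{st})$. For each pair with $m_{st}=\infty$ choose a real number $c_{st}=c_{ts}\ge 1$. Let $V=\mathbb R^S$ with basis of simple roots $\Delta=\{\alpha_s\}_{s\in S}$, and let $\mathcal B$ be the symmetric bilinear form on $V$ with $\mathcal B(\alpha_s,\alpha_t)=-\cos(\pi/m_{st})$ if $m_{st}<\infty$ and $\mathcal B(\alpha_s,\alpha_t)=-c_{st}$ if $m_{st}=\infty$. Let $W$ act on $V$ through the geometric representation, in which $s\in S$ acts by the reflection $\mathbf x\mapsto \mathbf x-2\mathcal B(\mathbf x,\alpha_s)\alpha_s$, and hence on the projective space $\mathbb PV$. Assume that the system is Lorentzian, i.e. that $\mathcal B$ has signature $(n-1,1)$. Write $\widehat{\mathbf x}\in\mathbb PV$ for the line spanned by $\mathbf x\ne 0$, and let $\widehat Q=\{\widehat{\mathbf x}\mid \mathbf x\neq 0,\ \mathcal B(\mathbf x,\mathbf x)=0\}$ be the projective light cone; its points are called light-like. Given a sequence $(w_k)_{k\in\mathbb N}$ in $W$ and points $x_0,x\in\mathbb PV$, we say that $x$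 is a limit direction arising from the base point $x_0$ through $(w_k)$ if the sequence $(w_k\cdot x_0)_{k\in\mathbb N}$ is injective and converges to $x$. Let $\Phi=W(\Delta)$ be the set of roots. A point $x\in\mathbb PV$ is a limit root if there is an injective sequence $(\gamma_k)_{k\in\mathbb N}$ in $\Phi$ with $\widehat{\gamma_k}\to x$. Then: 1. Every limit direction $x\in\widehat Q$, arising from any base point $x_0\in\mathbb PV$ through any sequence in $W$, is a limit root. 2. In particular, every limit direction arising from a light-like base point $x_0\in\widehat Q$ is a limit root. 3. For every sequence $(w_k)_{k\in\mathbb N}$ in $W$ there is a point $p\in\widehat Q$ such that all limit directions in $\widehat Q$ that arise through $(w_k)$ from base points different from $p$ coincide. In particular, all limit directions in $\widehat Q$ that arise through $(w_k)$ from base points outside $\widehat Q$ coincide. -/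

import Mathlib

open Filter Topology
open scoped LinearAlgebra.Projectivization

/-- The real projective space of a topological vector space carries the quotient topology of
`V \ {0}`. -/
noncomputable instance Projectivization.instTopologicalSpaceReal {V : Type*} [AddCommGroup V] [Module ℝ V]
    [TopologicalSpace V] : TopologicalSpace (ℙ ℝ V) :=
  TopologicalSpace.coinduced (Projectivization.mk' ℝ : {v : V // v ≠ 0} → ℙ ℝ V) inferInstance

/-- A geometric Coxeter system `(W, S)_B`: a Coxeter system together with a choice of weights
`c s t = c t s ≥ 1` for the pairs with `m s t = ∞`. Mathlib encodes `m s t = ∞` as `M s t = 0`;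
the values of `c` at the other pairs play no role. -/
structure GeometricCoxeterSystem (S W : Type*) [Group W] where
  /-- the Coxeter matrix -/
  M : CoxeterMatrix S
  /-- the Coxeter system -/
  cs : CoxeterSystem M W
  /-- the weights of the pairs with `m s t = ∞` -/
  c : S → S → ℝ
  c_symm : ∀ s t, M s t = 0 → c s t = c t s
  one_le_c : ∀ s t, M s t = 0 → 1 ≤ c s t

namespace GeometricCoxeterSystem

noncomputable section

variable {S W : Type*} [Group W] (G : GeometricCoxeterSystem S W)

/-- The matrix `B`. -/
def matrixB : Matrix S S ℝ :=
  Matrix.of fun s t => if G.M s t = 0 then -G.c s t else -Real.cos (Real.pi / G.M s t)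

theorem matrixB_self (s : S) : G.matrixB s s = 1 := by
  simp [matrixB]

variable [Fintype S] [DecidableEq S]

/-- The bilinear form on `V = ℝ^S` given by `B`. -/
def form : LinearMap.BilinForm ℝ (S → ℝ) := Matrix.toBilin' G.matrixB

/-- The system is Lorentzian if `B` has signature `(n - 1, 1)`, where `n = |S|`. -/
def IsLorentzian : Prop :=
  sigPos (LinearMap.BilinMap.toQuadraticMap G.form) + 1 = Fintype.card S ∧
    sigNeg (LinearMap.BilinMap.toQuadraticMap G.form) = 1

/-- The simple root `α_s`, a standard basis vector of `V = ℝ^S`. -/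
def simpleRoot (_G : GeometricCoxeterSystem S W) (s : S) : S → ℝ := Pi.single s 1

theorem form_simpleRoot (s t : S) :
    G.form (G.simpleRoot s) (G.simpleRoot t) = G.matrixB s t := by
  simp [form, simpleRoot]

/-- The reflection `x ↦ x - 2 (B(x, α) / B(α, α)) α` in a vector `α` with `B(α, α) ≠ 0`. -/
def reflection (α : S → ℝ) (h : G.form α α ≠ 0) : (S → ℝ) ≃ₗ[ℝ] (S → ℝ) :=
  Module.reflection (x := α) (f := (2 / G.form α α) • G.form.flip α) (by simp [h])

theorem reflection_apply (α : S → ℝ) (h : G.form α α ≠ 0) (x : S → ℝ) :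
    G.reflection α h x = x - (2 * (G.form x α / G.form α α)) • α := by
  rw [reflection, Module.reflection_apply]
  congr 2
  simp
  ring

theorem form_simpleRoot_self_ne_zero (s : S) :
    G.form (G.simpleRoot s) (G.simpleRoot s) ≠ 0 := by
  rw [form_simpleRoot, matrixB_self]
  exact one_ne_zero

/-- The reflection `σ_s` in the simple root `α_s`. -/
def simpleReflection (s : S) : (S → ℝ) ≃ₗ[ℝ] (S → ℝ) :=
  G.reflection (G.simpleRoot s) (G.form_simpleRoot_self_ne_zero s)

/-- The reflections in the simple roots satisfy the Coxeter relations. -/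
theorem isLiftable_simpleReflection : G.M.IsLiftable G.simpleReflection := by
  intro s t
  by_cases h0 : G.M s t = 0
  · simp [h0]
  have hst : G.form (G.simpleRoot s) (G.simpleRoot t) = -Real.cos (Real.pi / G.M s t) := by
    rw [form_simpleRoot]; simp [matrixB, h0]
  have hts : G.form (G.simpleRoot t) (G.simpleRoot s) = -Real.cos (Real.pi / G.M s t) := by
    rw [form_simpleRoot]; simp [matrixB, G.M.symmetric t s, h0]
  have hself : ∀ u, G.form (G.simpleRoot u) (G.simpleRoot u) = 1 := fun u => by
    rw [form_simpleRoot, matrixB_self]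
  obtain h1 | h2 | h3 : G.M s t = 1 ∨ G.M s t = 2 ∨ 3 ≤ G.M s t := by omega
  · have : s = t := by
      by_contra hne
      exact G.M.off_diagonal s t hne h1
    subst this
    rw [h1, pow_one]
    apply LinearEquiv.ext
    intro x
    exact Module.involutive_reflection (by simp [hself]) x
  · rw [h2] at hst hts ⊢
    have hc : Real.cos (Real.pi / (2 : ℕ)) = 0 := by
      push_cast; exact Real.cos_pi_div_two
    rw [hc, neg_zero] at hst hts
    apply LinearEquiv.ext
    intro x
    simp only [pow_two, LinearEquiv.mul_apply, simpleReflection, reflection_apply, map_sub,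
      map_smul, hst, hts, hself,
      LinearEquiv.coe_one, id]
    simp
    module
  · generalize hm : G.M s t = m at *
    have hmR : (3 : ℝ) ≤ m := by exact_mod_cast h3
    have hθ : 0 < Real.sin (2 * (Real.pi / m)) := by
      apply Real.sin_pos_of_pos_of_lt_pi
      · have := Real.pi_pos
        positivity
      · rw [← mul_div_assoc, div_lt_iff₀ (by linarith)]
        nlinarith [Real.pi_pos]
    set θ := 2 * (Real.pi / m) with hθdef
    have hmθ : (m : ℝ) * θ = 2 * Real.pi := by
      rw [hθdef]; field_simp
    have hS : ∀ k : ℤ, (Polynomial.Chebyshev.S ℝ k).eval (2 * Real.cos θ)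
        = Real.sin ((k + 1) * θ) / Real.sin θ := fun k => by
      rw [eq_div_iff hθ.ne', Polynomial.Chebyshev.S_two_mul_real_cos]
    apply LinearEquiv.ext
    intro x
    rw [simpleReflection, simpleReflection, reflection, reflection,
      Module.reflection_mul_reflection_pow_apply _ _ m x (2 * Real.cos θ) (by
        simp [hself, hst, hts, hθdef, Real.cos_two_mul]; ring)]
    have key : (Polynomial.Chebyshev.S ℝ (((m : ℤ) - 2) / 2)).eval (2 * Real.cos θ) *
          ((Polynomial.Chebyshev.S ℝ (((m : ℤ) - 1) / 2)).eval (2 * Real.cos θ) +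
          (Polynomial.Chebyshev.S ℝ (((m : ℤ) - 3) / 2)).eval (2 * Real.cos θ)) = 0 ∧
        (Polynomial.Chebyshev.S ℝ (((m : ℤ) - 1) / 2)).eval (2 * Real.cos θ) *
          ((Polynomial.Chebyshev.S ℝ ((m : ℤ) / 2)).eval (2 * Real.cos θ) +
          (Polynomial.Chebyshev.S ℝ (((m : ℤ) - 2) / 2)).eval (2 * Real.cos θ)) = 0 := by
      obtain ⟨k, hk | hk⟩ := Nat.even_or_odd' m
      · have e1 : ((m : ℤ) - 2) / 2 = k - 1 := by omega
        have e2 : ((m : ℤ) - 1) / 2 = k - 1 := by omega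
        have z : (Polynomial.Chebyshev.S ℝ ((k : ℤ) - 1)).eval (2 * Real.cos θ) = 0 := by
          rw [hS]
          have : (((k : ℤ) - 1 : ℤ) + 1 : ℝ) * θ = Real.pi := by
            rw [hk] at hmθ
            push_cast at hmθ ⊢
            linarith
          rw [this, Real.sin_pi, zero_div]
        rw [e1, e2, z]
        simp
      · have e1 : ((m : ℤ) - 2) / 2 = k - 1 := by omega
        have e2 : ((m : ℤ) - 1) / 2 = k := by omega
        have e3 : ((m : ℤ) - 3) / 2 = k - 1 := by omega
        have e4 : (m : ℤ) / 2 = k := by omega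
        have z : (Polynomial.Chebyshev.S ℝ (k : ℤ)).eval (2 * Real.cos θ) +
            (Polynomial.Chebyshev.S ℝ ((k : ℤ) - 1)).eval (2 * Real.cos θ) = 0 := by
          rw [hS, hS]
          have : (((k : ℤ) : ℝ) + 1) * θ = 2 * Real.pi - (((k : ℤ) - 1 : ℤ) + 1 : ℝ) * θ := by
            rw [hk] at hmθ
            push_cast at hmθ ⊢
            linarith
          rw [this, Real.sin_two_pi_sub]
          ring
        rw [e1, e2, e3, e4, z]
        simp
    rw [key.1, key.2]
    simp

/-- The geometric representation `ρ : W → GL(V)`, the homomorphism sending each generator `s` to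
the reflection in `α_s`. -/
def rep : W →* ((S → ℝ) ≃ₗ[ℝ] (S → ℝ)) :=
  G.cs.lift ⟨G.simpleReflection, G.isLiftable_simpleReflection⟩

theorem rep_simple (s : S) : G.rep (G.cs.simple s) = G.simpleReflection s :=
  G.cs.lift_apply_simple G.isLiftable_simpleReflection s

/-- The set `Φ = W(Δ)` of roots. -/
def roots : Set (S → ℝ) := {γ | ∃ (w : W) (s : S), γ = G.rep w (G.simpleRoot s)}

theorem ne_zero_of_mem_roots {γ : S → ℝ} (h : γ ∈ G.roots) : γ ≠ 0 := by
  obtain ⟨w, s, rfl⟩ := h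
  simp [simpleRoot]

/-- The set `E_Φ` of limit roots: limits in `ℙV` of the directions of injective sequences of
roots. -/
def limitRoots : Set (ℙ ℝ (S → ℝ)) :=
  {x | ∃ (γ : ℕ → S → ℝ) (hγ : ∀ k, γ k ∈ G.roots), Function.Injective γ ∧
    Tendsto (fun k => Projectivization.mk ℝ (γ k) (G.ne_zero_of_mem_roots (hγ k))) atTop (𝓝 x)}

/-- The projective light cone. -/
def projLightCone : Set (ℙ ℝ (S → ℝ)) :=
  {x | ∃ (v : S → ℝ) (hv : v ≠ 0), G.form v v = 0 ∧ x = Projectivization.mk ℝ v hv}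

/-- The point `x` of `ℙV` is a limit direction arising from the base point `x₀` through the
sequence `w`: the sequence of points `w k · x₀` is injective and converges to `x`. -/
def ArisesThrough (w : ℕ → W) (x₀ x : ℙ ℝ (S → ℝ)) : Prop :=
  Function.Injective (fun k => G.rep (w k) • x₀) ∧
    Tendsto (fun k => G.rep (w k) • x₀) atTop (𝓝 x)

end

end GeometricCoxeterSystem

/-!
The group `W` acts by isometries of a Lorentzian form `B`, and it acts discretely: if `w ≠ 1`, then
`w` maps some simple root to a nonpositive combination of simple roots, so only `w = 1` is close to
the identity. Along a sequence of distinct elements of `W` the operator norms therefore tend to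
infinity, and the isometries divided by their norms converge along a subsequence to a nonzero map
with totally isotropic image. In Lorentzian signature this image is a line, so the limit has the
form `x ↦ B q x • u`, with `u` and `q` isotropic.

Projectively, every point off the hyperplane `q^⊥` is attracted to `û`, and so are the directions of
infinitely many roots: `û` is a limit root. Comparing `B (w_k x) (w_k y) = B x y` with the rescaled
limits shows that a light-like limit from a base point other than `q̂` is orthogonal to `u`, hence
equal to `û`. The inverses contract in the same way to `q̂`, so `q̂` is a limit root as well, and
limits arising from the base point `q̂` are limit roots because the limit roots form a closed
`W`-invariant set.
-/

section ProjectiveSpace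

variable {V : Type*} [AddCommGroup V] [Module ℝ V] [TopologicalSpace V]

theorem isOpenQuotientMap_projectivization_mk' [ContinuousConstSMul ℝ V] :
    IsOpenQuotientMap (Projectivization.mk' ℝ : {v : V // v ≠ 0} → ℙ ℝ V) where
  surjective x := ⟨⟨x.rep, x.rep_nonzero⟩, x.mk_rep⟩
  continuous := continuous_coinduced_rng
  isOpenMap U hU := by
    have hsat : Projectivization.mk' ℝ ⁻¹' (Projectivization.mk' ℝ '' U) =
        ⋃ c : ℝˣ, (fun v : {v : V // v ≠ 0} => ⟨c • v.1, smul_ne_zero c.ne_zero v.2⟩) ⁻¹' U := by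
      ext v
      simp only [Set.mem_preimage, Set.mem_image, Set.mem_iUnion]
      constructor
      · rintro ⟨u, hu, huv⟩
        obtain ⟨c, hc⟩ := (Projectivization.mk_eq_mk_iff ℝ _ _ u.2 v.2).1 huv
        exact ⟨c, by simpa only [hc] using hu⟩
      · rintro ⟨c, hc⟩
        exact ⟨_, hc, (Projectivization.mk_eq_mk_iff ℝ _ _ _ v.2).2 ⟨c, rfl⟩⟩
    refine isOpen_coinduced.2 (hsat ▸ isOpen_iUnion fun c => hU.preimage ?_)
    exact (continuous_subtype_val.const_smul c).subtype_mk _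

theorem secondCountableTopology_projectivization [ContinuousConstSMul ℝ V]
    [SecondCountableTopology V] : SecondCountableTopology (ℙ ℝ V) :=
  have : SecondCountableTopology {v : V // v ≠ 0} :=
    TopologicalSpace.Subtype.secondCountableTopology _
  isOpenQuotientMap_projectivization_mk'.isQuotientMap.secondCountableTopology
    isOpenQuotientMap_projectivization_mk'.isOpenMap

theorem continuous_smul_projectivization {g : V ≃ₗ[ℝ] V} (hg : Continuous g) :
    Continuous fun x : ℙ ℝ V => g • x :=
  continuous_coinduced_dom.2 <| continuous_coinduced_rng.comp <|
    (hg.comp continuous_subtype_val).subtype_mk fun v => g.map_ne_zero_iff.2 v.2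

section Limits

variable [SeparatingDual ℝ V] {ι : Type*} {l : Filter ι} {v : ι → V}
  (hv : ∀ k, v k ≠ 0) {a : V} (ha : a ≠ 0)

theorem exists_tendsto_smul_of_tendsto_projectivization_mk [ContinuousSMul ℝ V]
    (h : Tendsto (fun k => Projectivization.mk ℝ (v k) (hv k)) l
      (𝓝 (Projectivization.mk ℝ a ha))) :
    ∃ c : ι → ℝ, Tendsto (fun k => c k • v k) l (𝓝 a) := by
  obtain ⟨f, hfa⟩ := SeparatingDual.exists_ne_zero (R := ℝ) ha
  let normalize : ℙ ℝ V → V :=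
    Projectivization.lift (fun v : {v : V // v ≠ 0} => (f a / f v) • v.1) (by
      rintro ⟨x, hx⟩ ⟨y, hy⟩ t rfl
      have ht : t ≠ 0 := left_ne_zero_of_smul hx
      simp only [map_smul, smul_eq_mul, smul_smul]
      congr 1
      field_simp)
  have hnormalize : ContinuousAt normalize (Projectivization.mk ℝ a ha) := by
    refine (isOpenQuotientMap_projectivization_mk'.continuousAt_comp_iff (x := ⟨a, ha⟩)).1 ?_
    have hf : Continuous fun v : {v : V // v ≠ 0} => f v :=
      f.continuous.comp continuous_subtype_val
    exact (continuousAt_const.div hf.continuousAt hfa).smul continuousAt_subtype_val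
  have hval : normalize (Projectivization.mk ℝ a ha) = a := by
    change (f a / f a) • a = a
    rw [div_self hfa, one_smul]
  have hlim := hnormalize.tendsto.comp h
  rw [hval] at hlim
  exact ⟨fun k => f a / f (v k), hlim⟩

theorem tendsto_projectivization_mk_of_tendsto_smul {c : ι → ℝ}
    (hc : Tendsto (fun k => c k • v k) l (𝓝 a)) :
    Tendsto (fun k => Projectivization.mk ℝ (v k) (hv k)) l
      (𝓝 (Projectivization.mk ℝ a ha)) := by
  obtain ⟨f, hfa⟩ := SeparatingDual.exists_ne_zero (R := ℝ) ha
  have hc0 : ∀ᶠ k in l, c k ≠ 0 := by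
    filter_upwards [((f.continuous.tendsto a).comp hc).eventually_ne hfa] with k hk h0
    simp [h0] at hk
  let d : ι → ℝ := fun k => if c k = 0 then 1 else c k
  have hd0 : ∀ k, d k ≠ 0 := fun k => by by_cases h : c k = 0 <;> simp [d, h]
  have hd : Tendsto (fun k => d k • v k) l (𝓝 a) :=
    hc.congr' (by filter_upwards [hc0] with k hk using by simp only [d, if_neg hk])
  have hsub : Tendsto (fun k => (⟨d k • v k, smul_ne_zero (hd0 k) (hv k)⟩ : {v : V // v ≠ 0})) l
      (𝓝 ⟨a, ha⟩) := tendsto_subtype_rng.2 hd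
  refine ((continuous_coinduced_rng.tendsto _).comp hsub).congr fun k => ?_
  exact (Projectivization.mk_eq_mk_iff' ℝ _ _ _ _).2 ⟨d k, rfl⟩

end Limits

end ProjectiveSpace

theorem mapClusterPt_cofinite_iff_exists_injective {X ι : Type*} [TopologicalSpace X]
    [FirstCountableTopology X] {x : X} {f : ι → X} :
    MapClusterPt x cofinite f ↔
      ∃ γ : ℕ → ι, Function.Injective γ ∧ Tendsto (f ∘ γ) atTop (𝓝 x) := by
  constructor
  · intro h
    classical
    obtain ⟨U, hU⟩ := (𝓝 x).exists_antitone_basis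
    have hinf : ∀ n, {i | f i ∈ U n}.Infinite := fun n =>
      frequently_cofinite_iff_infinite.1 (mapClusterPt_iff_frequently.1 h _ (hU.mem n))
    obtain ⟨p, hp, hlt⟩ := exists_seq_of_forall_finset_exists
      (fun p : ℕ × ι => f p.2 ∈ U p.1) (fun p p' => p.1 < p'.1 ∧ p.2 ≠ p'.2) fun s _ => by
        obtain ⟨i, hi, his⟩ := (hinf (s.sup Prod.fst + 1)).exists_notMem_finset (s.image Prod.snd)
        refine ⟨(s.sup Prod.fst + 1, i), hi, fun p hp => ⟨?_, fun h => his ?_⟩⟩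
        · exact Nat.lt_succ_of_le (Finset.le_sup (f := Prod.fst) hp)
        · exact Finset.mem_image.2 ⟨p, hp, h⟩
    have hmono : StrictMono fun n => (p n).1 := fun m n hmn => (hlt m n hmn).1
    refine ⟨fun n => (p n).2, .of_lt_imp_ne fun m n hmn => (hlt m n hmn).2, ?_⟩
    exact hU.tendsto fun n => hU.antitone hmono.le_apply (hp n)
  · rintro ⟨γ, hγ, hlim⟩
    have hcluster : MapClusterPt x atTop (f ∘ γ) := hlim.mapClusterPt
    exact hcluster.of_comp (Nat.cofinite_eq_atTop ▸ hγ.tendsto_cofinite)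

section BilinForm

variable {V : Type*} [AddCommGroup V] [Module ℝ V]

theorem exists_bilinForm_apply_ne_zero {B : LinearMap.BilinForm ℝ V} {q : V}
    (hB : B.Nondegenerate) (hq : q ≠ 0) : ∃ x, B q x ≠ 0 := by
  by_contra! hzero
  exact hq (hB.1 q hzero)

theorem exists_ne_zero_quadraticForm_eq_zero {Q : QuadraticForm ℝ V} {e f : V} (he : Q e < 0)
    (hf : 0 < Q f) : ∃ v ≠ 0, Q v = 0 := by
  have hdiscrim : 0 ≤ discrim (Q e) (QuadraticMap.polar Q e f) (Q f) := by
    unfold discrim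
    nlinarith [mul_pos (neg_pos.2 he) hf, sq_nonneg (QuadraticMap.polar Q e f)]
  obtain ⟨x, hx⟩ := exists_quadratic_eq_zero he.ne ⟨_, (Real.mul_self_sqrt hdiscrim).symm⟩
  refine ⟨x • e + f, fun h => hf.not_ge ?_, ?_⟩
  · rw [← neg_eq_of_add_eq_zero_right h, QuadraticMap.map_neg, QuadraticMap.map_smul]
    exact smul_nonpos_of_nonneg_of_nonpos (mul_self_nonneg x) he.le
  · rw [QuadraticMap.map_add Q, QuadraticMap.map_smul, QuadraticMap.polar_smul_left]
    linear_combination hx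

/-- A symmetric bilinear form of signature `(n - 1, 1)` on a real vector space of dimension `n`. -/
structure IsLorentzianForm (B : LinearMap.BilinForm ℝ V) : Prop where
  isSymm : B.IsSymm
  sigPos_add_one : sigPos B.toQuadraticMap + 1 = Module.finrank ℝ V
  sigNeg_eq_one : sigNeg B.toQuadraticMap = 1

namespace IsLorentzianForm

variable [FiniteDimensional ℝ V] {B : LinearMap.BilinForm ℝ V}

theorem nondegenerate (hB : IsLorentzianForm B) : B.Nondegenerate := by
  have hradical : B.toQuadraticMap.radical = ⊥ := by
    have hdim := QuadraticForm.sigPos_add_sigNeg_add_radical (Q := B.toQuadraticMap)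
    rw [hB.sigNeg_eq_one, hB.sigPos_add_one] at hdim
    exact Submodule.finrank_eq_zero.1 (by lia)
  have hassociated : QuadraticMap.associated B.toQuadraticMap = B :=
    QuadraticMap.associated_left_inverse ℝ hB.isSymm.eq
  rw [← hassociated]
  exact QuadraticMap.nondegenerate_associated_iff.2
    (QuadraticMap.nondegenerate_iff_radical_eq_bot.2 hradical)

theorem exists_smul_eq (hB : IsLorentzianForm B) {u x : V} (hu0 : u ≠ 0) (hu : B u u = 0)
    (hx : B x x = 0) (hux : B u x = 0) : ∃ c : ℝ, c • u = x := by
  by_contra! hne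
  have hli := (LinearIndependent.pair_iff' hu0).2 hne
  have hplane : ∀ y ∈ Submodule.span ℝ (Set.range ![u, x]), B.toQuadraticMap y ≤ 0 := by
    intro y hy
    rw [Matrix.range_cons_cons_empty, Submodule.mem_span_pair] at hy
    obtain ⟨a, b, rfl⟩ := hy
    simp [hu, hx, hux, hB.isSymm.eq x u]
  have hdim := QuadraticForm.sigPos_add_finrank_le_of_nonpos hplane
  rw [finrank_span_eq_card hli, ← hB.sigPos_add_one, Fintype.card_fin] at hdim
  lia

theorem exists_neg (hB : IsLorentzianForm B) : ∃ e, B e e < 0 := by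
  obtain ⟨N, hN, hneg⟩ := exists_finrank_eq_sigNeg_and_negDef B.toQuadraticMap
  rw [hB.sigNeg_eq_one] at hN
  have : Nontrivial N := Module.nontrivial_of_finrank_pos (R := ℝ) (hN ▸ one_pos)
  obtain ⟨e, he⟩ := exists_ne (0 : N)
  exact ⟨e, by simpa using hneg e he⟩

/-- A totally isotropic subspace is at most a line, so a linear map onto one has rank one. -/
theorem exists_forall_apply_eq_smul (hB : IsLorentzianForm B) {A : V →ₗ[ℝ] V} (hA : A ≠ 0)
    (hiso : ∀ x y, B (A x) (A y) = 0) : ∃ u q, u ≠ 0 ∧ q ≠ 0 ∧ ∀ v, A v = B q v • u := by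
  obtain ⟨x, hx : A x ≠ 0⟩ := DFunLike.ne_iff.1 hA
  obtain ⟨f, hf⟩ := Module.Projective.exists_dual_eq_one ℝ hx
  let q := (B.toDual hB.nondegenerate).symm (f ∘ₗ A)
  have hq : ∀ v, A v = B q v • A x := fun v => by
    obtain ⟨c, hc⟩ := hB.exists_smul_eq hx (hiso x x) (hiso v v) (hiso x v)
    simp [q, ← hc, hf]
  refine ⟨A x, q, hx, fun h => hx ?_, hq⟩
  rw [hq, h, LinearMap.map_zero₂, zero_smul]

end IsLorentzianForm

end BilinForm

section Topology

variable {V : Type*} [NormedAddCommGroup V] [NormedSpace ℝ V] [FiniteDimensional ℝ V]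
  {ι : Type*} {l : Filter ι}

theorem tendsto_bilinForm_apply (B : LinearMap.BilinForm ℝ V) {x y : ι → V} {a b : V}
    (hx : Tendsto x l (𝓝 a)) (hy : Tendsto y l (𝓝 b)) :
    Tendsto (fun k => B (x k) (y k)) l (𝓝 (B a b)) :=
  (B.toContinuousBilinearMap.continuous₂.tendsto (a, b)).comp (hx.prodMk_nhds hy)

theorem tendsto_of_forall_tendsto_bilinForm {B : LinearMap.BilinForm ℝ V} (hB : B.Nondegenerate)
    {y : ι → V} {b : V} (h : ∀ x, Tendsto (fun k => B x (y k)) l (𝓝 (B x b))) :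
    Tendsto y l (𝓝 b) := by
  let e := Module.finBasis ℝ V
  have hcoord : ∀ i, Tendsto (fun k => e.coord i (y k)) l (𝓝 (e.coord i b)) := fun i => by
    simpa only [LinearMap.BilinForm.apply_toDual_symm_apply] using
      h ((B.toDual hB).symm (e.coord i))
  have hsum := tendsto_finsetSum Finset.univ fun i _ => (hcoord i).smul_const (e i)
  simpa only [Module.Basis.coord_apply, Module.Basis.sum_repr] using hsum

end Topology

section Rescaling

variable {E : Type*} [NormedAddCommGroup E] [NormedSpace ℝ E] {ι : Type*} {l : Filter ι}

theorem tendsto_norm_atTop_of_tendsto_inv_smul {N : ι → ℝ} (hN : Tendsto N l atTop) {y : ι → E}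
    {b : E} (hb : b ≠ 0) (h : Tendsto (fun k => (N k)⁻¹ • y k) l (𝓝 b)) :
    Tendsto (fun k => ‖y k‖) l atTop := by
  refine (hN.atTop_mul_pos (norm_pos_iff.2 hb) h.norm).congr' ?_
  filter_upwards [hN.eventually_gt_atTop 0] with k hk
  rw [norm_smul, norm_inv, Real.norm_of_nonneg hk.le, mul_inv_cancel_left₀ hk.ne']

theorem tendsto_zero_of_tendsto_smul_of_tendsto_norm_atTop {c : ι → ℝ} {y : ι → E} {a : E}
    (h : Tendsto (fun k => c k • y k) l (𝓝 a)) (hy : Tendsto (fun k => ‖y k‖) l atTop) :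
    Tendsto c l (𝓝 0) := by
  rw [tendsto_zero_iff_norm_tendsto_zero]
  refine (h.norm.div_atTop hy).congr' ?_
  filter_upwards [hy.eventually_ne_atTop 0] with k hk
  rw [norm_smul, mul_div_cancel_right₀ _ hk]

theorem exists_subseq_tendsto_inv_norm_smul [ProperSpace E] {x : ℕ → E}
    (hx : Tendsto (fun k => ‖x k‖) atTop atTop) :
    ∃ a ≠ 0, ∃ φ : ℕ → ℕ, StrictMono φ ∧
      Tendsto (fun k => ‖x (φ k)‖⁻¹ • x (φ k)) atTop (𝓝 a) := by
  have hsphere : ∃ᶠ k in atTop, ‖x k‖⁻¹ • x k ∈ Metric.sphere 0 1 := by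
    refine Eventually.frequently ?_
    filter_upwards [hx.eventually_ne_atTop 0] with k hk
    rw [mem_sphere_zero_iff_norm, norm_smul, norm_inv, norm_norm, inv_mul_cancel₀ hk]
  obtain ⟨a, ha, φ, hφ, hlim⟩ := (isCompact_sphere (0 : E) 1).tendsto_subseq' hsphere
  exact ⟨a, ne_zero_of_mem_unit_sphere ⟨a, ha⟩, φ, hφ, hlim⟩

end Rescaling

section Contraction

variable {V : Type*} [NormedAddCommGroup V] [NormedSpace ℝ V] {B : LinearMap.BilinForm ℝ V}
  {ι : Type*} {l : Filter ι} {g : ι → V ≃ₗ[ℝ] V} {u q : V}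

section Isometries

variable [FiniteDimensional ℝ V] (hg : ∀ k x y, B (g k x) (g k y) = B x y)
include hg

theorem tendsto_mul_mul_bilinForm_of_tendsto_smul {c d : ι → ℝ} {x y a b : V}
    (hx : Tendsto (fun k => c k • g k x) l (𝓝 a)) (hy : Tendsto (fun k => d k • g k y) l (𝓝 b)) :
    Tendsto (fun k => c k * d k * B x y) l (𝓝 (B a b)) := by
  refine (tendsto_bilinForm_apply B hx hy).congr fun k => ?_
  rw [map_smul, LinearMap.map_smul₂, hg, smul_eq_mul, smul_eq_mul]
  ring

theorem bilinForm_eq_zero_of_tendsto_smul [l.NeBot] {c d : ι → ℝ} {x y a b : V}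
    (hc : Tendsto c l (𝓝 0)) (hd : Tendsto d l (𝓝 0))
    (hx : Tendsto (fun k => c k • g k x) l (𝓝 a)) (hy : Tendsto (fun k => d k • g k y) l (𝓝 b)) :
    B a b = 0 := by
  refine tendsto_nhds_unique (tendsto_mul_mul_bilinForm_of_tendsto_smul hg hx hy) ?_
  simpa only [zero_mul] using (hc.mul hd).mul_const (B x y)

theorem tendsto_zero_of_tendsto_smul_of_bilinForm_ne_zero {c : ι → ℝ} {v a : V} (hv : B v v ≠ 0)
    (ha : B a a = 0) (hlim : Tendsto (fun k => c k • g k v) l (𝓝 a)) : Tendsto c l (𝓝 0) := by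
  have hsq : Tendsto (fun k => c k * c k) l (𝓝 0) := by
    have hmul := tendsto_mul_mul_bilinForm_of_tendsto_smul hg hlim hlim
    simpa only [ha, mul_inv_cancel_right₀ hv, zero_mul] using hmul.mul_const (B v v)⁻¹
  rw [tendsto_zero_iff_abs_tendsto_zero]
  simpa only [Function.comp_def, Real.sqrt_mul_self_eq_abs, Real.sqrt_zero] using hsq.sqrt

end Isometries

/-- Along `l`, suitable multiples of the linear maps `g k` converge to the map `x ↦ B q x • u` of
rank at most one, with multipliers `(N k)⁻¹` tending to `0`. If `u ≠ 0`, then on the projective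
space every point off the hyperplane `B q x = 0` is attracted to the direction of `u`. -/
def ContractsTo (B : LinearMap.BilinForm ℝ V) (g : ι → V ≃ₗ[ℝ] V) (l : Filter ι) (u q : V) :
    Prop :=
  ∃ N : ι → ℝ, Tendsto N l atTop ∧ ∀ x, Tendsto (fun k => (N k)⁻¹ • g k x) l (𝓝 (B q x • u))

namespace ContractsTo

theorem tendsto_norm_apply (h : ContractsTo B g l u q) (hu : u ≠ 0) {x : V} (hx : B q x ≠ 0) :
    Tendsto (fun k => ‖g k x‖) l atTop := by
  obtain ⟨N, hN, hlim⟩ := h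
  exact tendsto_norm_atTop_of_tendsto_inv_smul hN (smul_ne_zero hx hu) (hlim x)

theorem tendsto_smul_mk (h : ContractsTo B g l u q) (hu : u ≠ 0) {x : V} (hx0 : x ≠ 0)
    (hx : B q x ≠ 0) :
    Tendsto (fun k => g k • Projectivization.mk ℝ x hx0) l (𝓝 (Projectivization.mk ℝ u hu)) := by
  obtain ⟨N, -, hlim⟩ := h
  refine tendsto_projectivization_mk_of_tendsto_smul (fun k => (g k).map_ne_zero_iff.2 hx0) hu
    (c := fun k => (B q x)⁻¹ * (N k)⁻¹) ?_
  simpa only [smul_smul, inv_mul_cancel₀ hx, one_smul] using (hlim x).const_smul (B q x)⁻¹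

variable [FiniteDimensional ℝ V] (hg : ∀ k x y, B (g k x) (g k y) = B x y)
include hg

theorem inv (h : ContractsTo B g l u q) (hB : B.Nondegenerate) (hsymm : B.IsSymm) :
    ContractsTo B (fun k => (g k)⁻¹) l q u := by
  obtain ⟨N, hN, hlim⟩ := h
  refine ⟨N, hN, fun y => tendsto_of_forall_tendsto_bilinForm hB fun x => ?_⟩
  have hadjoint : ∀ k, B x ((g k)⁻¹ y) = B (g k x) y := fun k =>
    (hg k _ _).symm.trans (congrArg _ ((g k).apply_symm_apply y))
  have hx := tendsto_bilinForm_apply B (hlim x) (tendsto_const_nhds (x := y))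
  simpa only [map_smul, LinearMap.smul_apply, smul_eq_mul, hadjoint, hsymm.eq x q,
    mul_comm (B u y)] using hx

theorem apply_eq_zero_of_tendsto_smul [l.NeBot] (h : ContractsTo B g l u q) (hB : B.Nondegenerate)
    (hq : q ≠ 0) {c : ι → ℝ} {v a : V} (hc : Tendsto c l (𝓝 0))
    (hlim : Tendsto (fun k => c k • g k v) l (𝓝 a)) : B u a = 0 := by
  obtain ⟨N, hN, hN_lim⟩ := h
  obtain ⟨x, hx⟩ := exists_bilinForm_apply_ne_zero hB hq
  have hzero := bilinForm_eq_zero_of_tendsto_smul hg (tendsto_inv_atTop_zero.comp hN) hc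
    (hN_lim x) hlim
  rw [LinearMap.map_smul₂, smul_eq_mul] at hzero
  exact (mul_eq_zero.1 hzero).resolve_left hx

theorem apply_self_eq_zero [l.NeBot] (h : ContractsTo B g l u q) (hB : B.Nondegenerate)
    (hq : q ≠ 0) : B u u = 0 := by
  obtain ⟨N, hN, hlim⟩ := id h
  obtain ⟨x, hx⟩ := exists_bilinForm_apply_ne_zero hB hq
  have hzero := h.apply_eq_zero_of_tendsto_smul hg hB hq (tendsto_inv_atTop_zero.comp hN) (hlim x)
  rw [map_smul, smul_eq_mul] at hzero
  exact (mul_eq_zero.1 hzero).resolve_left hx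

/-- The multipliers `c k` realizing the limit tend to `0`: off the hyperplane `q^⊥` because the
vectors `g k v` are unbounded, off the light cone because the `g k` are isometries. In Lorentzian
signature, the direction of `q` is the only light-like one in `q^⊥`. -/
theorem eq_mk_of_tendsto_smul_mk [l.NeBot] (h : ContractsTo B g l u q) (hB : IsLorentzianForm B)
    (hu : u ≠ 0) (hq : q ≠ 0) (hqq : B q q = 0) {x₀ : ℙ ℝ V}
    (hx₀ : x₀ ≠ Projectivization.mk ℝ q hq) {a : V} (ha : a ≠ 0) (haa : B a a = 0)
    (hlim : Tendsto (fun k => g k • x₀) l (𝓝 (Projectivization.mk ℝ a ha))) :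
    Projectivization.mk ℝ a ha = Projectivization.mk ℝ u hu := by
  induction x₀ using Projectivization.ind with | _ v hv =>
  obtain ⟨c, hc⟩ := exists_tendsto_smul_of_tendsto_projectivization_mk
    (fun k => (g k).map_ne_zero_iff.2 hv) ha hlim
  have hc0 : Tendsto c l (𝓝 0) := by
    by_cases hvv : B v v = 0
    · have hqv : B q v ≠ 0 := fun hqv => hx₀ <|
        (Projectivization.mk_eq_mk_iff' ℝ _ _ _ _).2 (hB.exists_smul_eq hq hqq hvv hqv)
      exact tendsto_zero_of_tendsto_smul_of_tendsto_norm_atTop hc (h.tendsto_norm_apply hu hqv)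
    · exact tendsto_zero_of_tendsto_smul_of_bilinForm_ne_zero hg hvv haa hc
  have hua := h.apply_eq_zero_of_tendsto_smul hg hB.nondegenerate hq hc0 hc
  have huu := h.apply_self_eq_zero hg hB.nondegenerate hq
  exact (Projectivization.mk_eq_mk_iff' ℝ _ _ _ _).2 (hB.exists_smul_eq hu huu haa hua)

end ContractsTo

theorem IsLorentzianForm.exists_subseq_contractsTo [FiniteDimensional ℝ V]
    (hB : IsLorentzianForm B) {g : ℕ → V ≃ₗ[ℝ] V} (hg : ∀ k x y, B (g k x) (g k y) = B x y)
    (hnorm : Tendsto (fun k => ‖LinearMap.toContinuousLinearMap (g k : V →ₗ[ℝ] V)‖) atTop atTop) :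
    ∃ φ : ℕ → ℕ, StrictMono φ ∧ ∃ u q, u ≠ 0 ∧ q ≠ 0 ∧ ContractsTo B (g ∘ φ) atTop u q := by
  have : ProperSpace (V →L[ℝ] V) := FiniteDimensional.proper_real _
  obtain ⟨A, hA, φ, hφ, hlim⟩ := exists_subseq_tendsto_inv_norm_smul hnorm
  let N : ℕ → ℝ := fun k => ‖LinearMap.toContinuousLinearMap (g (φ k) : V →ₗ[ℝ] V)‖
  have hN : Tendsto N atTop atTop := hnorm.comp hφ.tendsto_atTop
  have happly : ∀ x, Tendsto (fun k => (N k)⁻¹ • g (φ k) x) atTop (𝓝 (A x)) := fun x =>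
    ((ContinuousLinearMap.apply ℝ V x).continuous.tendsto A).comp hlim
  have hN0 : Tendsto (fun k => (N k)⁻¹) atTop (𝓝 0) := tendsto_inv_atTop_zero.comp hN
  have hiso : ∀ x y, B (A x) (A y) = 0 := fun x y =>
    bilinForm_eq_zero_of_tendsto_smul (fun k => hg (φ k)) hN0 hN0 (happly x) (happly y)
  obtain ⟨u, q, hu, hq, hrank⟩ := hB.exists_forall_apply_eq_smul (A := A.toLinearMap)
    (fun h => hA (ContinuousLinearMap.coe_injective h)) hiso
  exact ⟨φ, hφ, u, q, hu, hq, N, hN, fun x => hrank x ▸ happly x⟩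

end Contraction

section Discreteness

variable {V : Type*} [NormedAddCommGroup V] [NormedSpace ℝ V] [FiniteDimensional ℝ V]
  {B : LinearMap.BilinForm ℝ V} {Γ : Type*} [Group Γ] {ρ : Γ →* V ≃ₗ[ℝ] V}

theorem tendsto_inv_mul_succ_apply (hB : B.Nondegenerate)
    (hρ : ∀ γ x y, B (ρ γ x) (ρ γ y) = B x y) {γ : ℕ → Γ} {A : V → V}
    (hlim : ∀ x, Tendsto (fun k => ρ (γ k) x) atTop (𝓝 (A x))) (y : V) :
    Tendsto (fun k => ρ ((γ k)⁻¹ * γ (k + 1)) y) atTop (𝓝 y) := by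
  refine tendsto_of_forall_tendsto_bilinForm hB fun x => ?_
  have hA : B (A x) (A y) = B x y :=
    tendsto_nhds_unique (tendsto_bilinForm_apply B (hlim x) (hlim y))
      (by simp only [hρ, tendsto_const_nhds])
  have hadjoint : ∀ k, B x (ρ ((γ k)⁻¹ * γ (k + 1)) y) = B (ρ (γ k) x) (ρ (γ (k + 1)) y) :=
    fun k => by rw [← hρ (γ k), ← LinearEquiv.mul_apply, ← map_mul, mul_inv_cancel_left]
  simpa only [hadjoint, hA, Function.comp_apply] using
    tendsto_bilinForm_apply B (hlim x) ((hlim y).comp (tendsto_add_atTop_nat 1))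

theorem tendsto_norm_cofinite_atTop_of_discrete (hB : B.Nondegenerate)
    (hρ : ∀ γ x y, B (ρ γ x) (ρ γ y) = B x y)
    (hdiscrete : ∀ γ : ℕ → Γ, (∀ x, Tendsto (fun k => ρ (γ k) x) atTop (𝓝 x)) →
      ∃ k, γ k = 1) :
    Tendsto (fun γ => ‖LinearMap.toContinuousLinearMap (ρ γ : V →ₗ[ℝ] V)‖) cofinite atTop := by
  have : ProperSpace (V →L[ℝ] V) := FiniteDimensional.proper_real _
  by_contra hbounded
  obtain ⟨C, hC⟩ := not_forall.1 (mt tendsto_atTop.2 hbounded)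
  have hball : ∃ᶠ γ in cofinite,
      LinearMap.toContinuousLinearMap (ρ γ : V →ₗ[ℝ] V) ∈ Metric.closedBall 0 C :=
    (not_eventually.1 hC).mono fun γ hγ => mem_closedBall_zero_iff.2 (not_le.1 hγ).le
  obtain ⟨A, -, hA⟩ := (isCompact_closedBall _ C).exists_mapClusterPt_of_frequently hball
  obtain ⟨γ, hγ, hlim⟩ := mapClusterPt_cofinite_iff_exists_injective.1 hA
  have happly : ∀ x, Tendsto (fun k => ρ (γ k) x) atTop (𝓝 (A x)) := fun x =>
    ((ContinuousLinearMap.apply ℝ V x).continuous.tendsto A).comp hlim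
  obtain ⟨k, hk⟩ := hdiscrete _ (tendsto_inv_mul_succ_apply hB hρ happly)
  exact k.succ_ne_self (hγ (inv_mul_eq_one.1 hk)).symm

end Discreteness

section Chebyshev

open Polynomial.Chebyshev

theorem eval_chebyshevU_nonneg_of_one_le {x : ℝ} (hx : 1 ≤ x) (n : ℕ) : 0 ≤ (U ℝ n).eval x := by
  induction n with
  | zero => simp
  | succ n ih =>
    rw [Nat.cast_succ, U_eq_X_mul_U_add_T, Polynomial.eval_add, Polynomial.eval_mul,
      Polynomial.eval_X]
    exact add_nonneg (mul_nonneg (by linarith) ih) (by linarith [one_le_eval_T_real (n + 1) hx])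

theorem eval_chebyshevU_cos_nonneg {θ : ℝ} (hθ : 0 < θ) {n : ℕ} (hn : (n + 1) * θ ≤ Real.pi) :
    0 ≤ (U ℝ n).eval (Real.cos θ) := by
  obtain rfl | hpos := Nat.eq_zero_or_pos n
  · simp
  have hθ_lt : θ < Real.pi := by nlinarith [mul_pos (Nat.cast_pos (α := ℝ).2 hpos) hθ]
  refine nonneg_of_mul_nonneg_left ?_ (Real.sin_pos_of_pos_of_lt_pi hθ hθ_lt)
  rw [U_real_cos]
  exact Real.sin_nonneg_of_nonneg_of_le_pi (by positivity) hn

end Chebyshev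

section Length

open CoxeterSystem

variable {S W : Type*} [Group W] {M : CoxeterMatrix S} {cs : CoxeterSystem M W} {v w : W}

theorem isReduced_of_length_mul_wordProd_eq {ω : List S}
    (h : cs.length (v * cs.wordProd ω) = cs.length v + ω.length) : cs.IsReduced ω := by
  refine (cs.length_wordProd_le ω).antisymm ?_
  have hle := cs.length_mul_le v (cs.wordProd ω)
  lia

theorem not_isRightDescent_of_length_mul_wordProd_cons_eq {i : S} {ω : List S}
    (h : cs.length (v * cs.wordProd (i :: ω)) = cs.length v + (i :: ω).length) :
    ¬ cs.IsRightDescent v i := by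
  intro hi
  have hlt : cs.length (v * cs.simple i) < cs.length v := hi
  have hle := cs.length_mul_le (v * cs.simple i) (cs.wordProd ω)
  rw [mul_assoc, ← cs.wordProd_cons] at hle
  have hω := cs.length_wordProd_le ω
  rw [List.length_cons] at h
  lia

theorem exists_eq_mul_wordProd_alternatingWord (s : S) {t : S} (ht : cs.IsRightDescent w t) :
    ∃ v k, w = v * cs.wordProd (alternatingWord s t (k + 1)) ∧
      cs.length w = cs.length v + (k + 1) ∧
      ¬ cs.IsRightDescent v s ∧ ¬ cs.IsRightDescent v t := by
  classical
  have hfactor : ∃ n v k, n = cs.length v ∧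
      w = v * cs.wordProd (alternatingWord s t (k + 1)) ∧ cs.length w = cs.length v + (k + 1) :=
    ⟨_, w * cs.simple t, 0, rfl, by simp [alternatingWord], (cs.isRightDescent_iff.1 ht).symm⟩
  obtain ⟨v, k, hv, hw, hlength⟩ := Nat.find_spec hfactor
  have hprev : ¬ cs.IsRightDescent v (if Even k then t else s) := by
    rw [alternatingWord_succ'] at hw
    refine not_isRightDescent_of_length_mul_wordProd_cons_eq (ω := alternatingWord s t k) ?_
    rw [← hw, hlength, List.length_cons, length_alternatingWord]
  have hnext : ¬ cs.IsRightDescent v (if Even (k + 1) then t else s) := by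
    intro hi
    rw [isRightDescent_iff] at hi
    refine Nat.find_min hfactor (m := cs.length (v * cs.simple (if Even (k + 1) then t else s)))
      (by lia) ⟨_, k + 1, rfl, ?_, by lia⟩
    rw [alternatingWord_succ' s t (k + 1), wordProd_cons, mul_assoc,
      simple_mul_simple_cancel_left, hw]
  refine ⟨v, k, hw, hlength, ?_⟩
  by_cases hk : Even k <;> simp_all [Nat.even_add_one]

theorem lt_of_not_isRightDescent_mul_wordProd_alternatingWord {s t : S} {k : ℕ} (hM : M s t ≠ 0)
    (hs : ¬ cs.IsRightDescent (v * cs.wordProd (alternatingWord s t k)) s)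
    (hlength : cs.length (v * cs.wordProd (alternatingWord s t k)) = cs.length v + k) :
    k < M s t := by
  have hreduced : cs.IsReduced (alternatingWord t s (k + 1)) := by
    refine isReduced_of_length_mul_wordProd_eq (v := v) ?_
    rw [not_isRightDescent_iff] at hs
    rw [length_alternatingWord, alternatingWord_succ, wordProd_concat, ← mul_assoc, hs, hlength,
      add_assoc]
  by_contra! hk
  rw [M.symmetric s t] at hM hk
  exact cs.not_isReduced_alternatingWord t s hM (Nat.lt_succ_of_le hk) hreduced

end Length

namespace GeometricCoxeterSystem

open CoxeterSystem Polynomial.Chebyshev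

variable {S W : Type*} [Group W] (G : GeometricCoxeterSystem S W)

theorem matrixB_symm (s t : S) : G.matrixB s t = G.matrixB t s := by
  simp only [matrixB, Matrix.of_apply, G.M.symmetric s t]
  split_ifs with h
  · rw [G.c_symm t s h]
  · rfl

/-- The coefficients `a k` of the roots of the dihedral subgroup generated by `s` and `t`: applying
an alternating word of length `k` to `α_s` gives `a (k + 1)` times one of the two simple roots plus
`a k` times the other. For `m_{st} < ∞` they are `sin (k π / m_{st}) / sin (π / m_{st})`, which
Chebyshev polynomials of the second kind extend to `m_{st} = ∞`. -/
noncomputable def dihedralCoeff (s t : S) (k : ℕ) : ℝ :=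
  (U ℝ ((k : ℤ) - 1)).eval (-G.matrixB s t)

theorem dihedralCoeff_zero (s t : S) : G.dihedralCoeff s t 0 = 0 := by
  simp [dihedralCoeff]

theorem dihedralCoeff_one (s t : S) : G.dihedralCoeff s t 1 = 1 := by
  simp [dihedralCoeff]

theorem dihedralCoeff_add_two (s t : S) (k : ℕ) : G.dihedralCoeff s t (k + 2) =
    -2 * G.matrixB s t * G.dihedralCoeff s t (k + 1) - G.dihedralCoeff s t k := by
  have hindex : ((k + 2 : ℕ) : ℤ) - 1 = (k - 1 : ℤ) + 2 ∧ ((k + 1 : ℕ) : ℤ) - 1 = (k - 1 : ℤ) + 1 :=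
    ⟨by lia, by lia⟩
  simp only [dihedralCoeff, hindex, U_add_two, Polynomial.eval_sub, Polynomial.eval_mul,
    Polynomial.eval_ofNat, Polynomial.eval_X]
  ring

theorem dihedralCoeff_nonneg {s t : S} {k : ℕ} (hk : G.M s t ≠ 0 → k ≤ G.M s t) :
    0 ≤ G.dihedralCoeff s t k := by
  obtain _ | k := k
  · exact (G.dihedralCoeff_zero s t).ge
  rw [dihedralCoeff, Nat.cast_succ, add_sub_cancel_right]
  by_cases hM : G.M s t = 0
  · have hc : -G.matrixB s t = G.c s t := by simp [matrixB, hM]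
    exact hc ▸ eval_chebyshevU_nonneg_of_one_le (G.one_le_c s t hM) k
  · have hcos : -G.matrixB s t = Real.cos (Real.pi / G.M s t) := by simp [matrixB, hM]
    have hM0 : (0 : ℝ) < G.M s t := Nat.cast_pos.2 (Nat.pos_of_ne_zero hM)
    rw [hcos]
    refine eval_chebyshevU_cos_nonneg (div_pos Real.pi_pos hM0) ?_
    rw [mul_div_assoc', div_le_iff₀ hM0, mul_comm]
    exact mul_le_mul_of_nonneg_left (mod_cast hk hM) Real.pi_pos.le

variable [Fintype S] [DecidableEq S]

theorem form_simpleRoot_self (s : S) : G.form (G.simpleRoot s) (G.simpleRoot s) = 1 := by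
  rw [form_simpleRoot, matrixB_self]

theorem simpleReflection_apply (s : S) (x : S → ℝ) :
    G.simpleReflection s x = x - (2 * G.form x (G.simpleRoot s)) • G.simpleRoot s := by
  rw [simpleReflection, reflection_apply, form_simpleRoot_self, div_one]

theorem rep_mul_apply (v w : W) (x : S → ℝ) : G.rep (v * w) x = G.rep v (G.rep w x) := by
  rw [map_mul, LinearEquiv.mul_apply]

theorem rep_alternatingWord_simpleRoot (s t : S) (k : ℕ) :
    G.rep (G.cs.wordProd (alternatingWord s t k)) (G.simpleRoot s) =
      if Even k then
        G.dihedralCoeff s t (k + 1) • G.simpleRoot s + G.dihedralCoeff s t k • G.simpleRoot t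
      else
        G.dihedralCoeff s t k • G.simpleRoot s + G.dihedralCoeff s t (k + 1) • G.simpleRoot t := by
  induction k with
  | zero => simp [alternatingWord, dihedralCoeff_zero, dihedralCoeff_one]
  | succ k ih =>
    rw [alternatingWord_succ', wordProd_cons, rep_mul_apply, ih, rep_simple,
      dihedralCoeff_add_two]
    by_cases hk : Even k
    · simp only [hk, Nat.even_add_one, not_true, if_true, if_false, map_add, map_smul,
        simpleReflection_apply, form_simpleRoot, matrixB_self]
      module
    · simp only [hk, Nat.even_add_one, not_false_eq_true, if_true, if_false, map_add, map_smul,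
        simpleReflection_apply, form_simpleRoot, matrixB_self, G.matrixB_symm t s]
      module

/-- Write `w = v d` with `v` having neither `s` nor `t` as a descent and `d` in the dihedral
subgroup: then `w α_s` is a nonnegative combination of the vectors `v α_s` and `v α_t`, which are
nonnegative by induction on the length. -/
theorem rep_simpleRoot_nonneg {w : W} {s : S} (hs : ¬ G.cs.IsRightDescent w s) :
    0 ≤ G.rep w (G.simpleRoot s) := by
  induction hn : G.cs.length w using Nat.strong_induction_on generalizing w s with
  | _ n ih =>
  obtain rfl | hw := eq_or_ne w 1
  · simp [simpleRoot]
  obtain ⟨t, ht⟩ := G.cs.exists_rightDescent_of_ne_one hw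
  obtain ⟨v, k, rfl, hlength, hvs, hvt⟩ := exists_eq_mul_wordProd_alternatingWord s ht
  have hk : G.M s t ≠ 0 → k + 2 ≤ G.M s t := fun hM =>
    lt_of_not_isRightDescent_mul_wordProd_alternatingWord hM hs hlength
  have hcoeff : ∀ j ≤ k + 2, 0 ≤ G.dihedralCoeff s t j := fun j hj =>
    G.dihedralCoeff_nonneg fun hM => hj.trans (hk hM)
  have hroot : ∀ j ≤ k + 2, ∀ i, ¬ G.cs.IsRightDescent v i →
      0 ≤ G.dihedralCoeff s t j • G.rep v (G.simpleRoot i) := fun j hj i hi =>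
    smul_nonneg (hcoeff j hj) (ih _ (by lia) hi rfl)
  rw [rep_mul_apply, rep_alternatingWord_simpleRoot]
  split_ifs <;> simp only [map_add, map_smul]
  · exact add_nonneg (hroot _ le_rfl s hvs) (hroot _ (by lia) t hvt)
  · exact add_nonneg (hroot _ (by lia) s hvs) (hroot _ le_rfl t hvt)

theorem eq_one_of_forall_rep_simpleRoot_pos {w : W}
    (h : ∀ s, 0 < G.rep w (G.simpleRoot s) s) : w = 1 := by
  by_contra hw
  obtain ⟨s, hs⟩ := G.cs.exists_rightDescent_of_ne_one hw
  have hneg : G.simpleReflection s (G.simpleRoot s) = -G.simpleRoot s := by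
    rw [simpleReflection_apply, form_simpleRoot_self]
    module
  have hnonneg := G.rep_simpleRoot_nonneg (G.cs.isRightDescent_iff_not_isRightDescent_mul.1 hs) s
  rw [rep_mul_apply, rep_simple, hneg, map_neg, Pi.neg_apply, Pi.zero_apply] at hnonneg
  exact (h s).not_ge (neg_nonneg.1 hnonneg)

theorem isSymm_form : G.form.IsSymm :=
  Matrix.isSymm_toBilin'_iff_isSymm.2 (Matrix.IsSymm.ext fun s t => G.matrixB_symm t s)

theorem form_rep_rep (w : W) (x y : S → ℝ) : G.form (G.rep w x) (G.rep w y) = G.form x y := by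
  induction w using G.cs.simple_induction_left generalizing x y with
  | one => simp
  | mul_simple_left w s ih =>
    rw [rep_mul_apply, rep_mul_apply, rep_simple, simpleReflection_apply, simpleReflection_apply,
      ← ih x y]
    simp only [map_sub, map_smul, LinearMap.sub_apply, LinearMap.smul_apply, smul_eq_mul,
      form_simpleRoot_self, G.isSymm_form.eq (G.simpleRoot s)]
    ring

theorem tendsto_norm_rep_cofinite_atTop (hB : G.form.Nondegenerate) :
    Tendsto (fun w => ‖LinearMap.toContinuousLinearMap (G.rep w : (S → ℝ) →ₗ[ℝ] S → ℝ)‖)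
      cofinite atTop := by
  refine tendsto_norm_cofinite_atTop_of_discrete hB G.form_rep_rep fun w hw => ?_
  have hpos : ∀ᶠ k in atTop, ∀ s, 0 < G.rep (w k) (G.simpleRoot s) s := by
    refine eventually_all.2 fun s => (tendsto_pi_nhds.1 (hw _) s).eventually_const_lt ?_
    simp [simpleRoot]
  exact hpos.exists.imp fun k hk => G.eq_one_of_forall_rep_simpleRoot_pos hk

theorem exists_form_simpleRoot_ne_zero (hB : G.form.Nondegenerate) {q : S → ℝ} (hq : q ≠ 0) :
    ∃ s, G.form q (G.simpleRoot s) ≠ 0 := by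
  by_contra! hzero
  have hform : G.form q = 0 :=
    (Pi.basisFun ℝ S).ext fun s => by simpa [simpleRoot] using hzero s
  exact hq (hB.1 q (LinearMap.congr_fun hform))

/-- The map `γ ↦ γ̂` from the roots to the projective space. The limit roots are its cluster points
along the cofinite filter. -/
noncomputable def rootDirection (γ : G.roots) : ℙ ℝ (S → ℝ) :=
  Projectivization.mk ℝ γ.1 (G.ne_zero_of_mem_roots γ.2)

theorem mem_limitRoots_iff_mapClusterPt {x : ℙ ℝ (S → ℝ)} :
    x ∈ G.limitRoots ↔ MapClusterPt x cofinite G.rootDirection := by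
  have := secondCountableTopology_projectivization (V := S → ℝ)
  rw [mapClusterPt_cofinite_iff_exists_injective]
  constructor
  · rintro ⟨γ, hγ, hinj, hlim⟩
    exact ⟨fun k => ⟨γ k, hγ k⟩, fun i j hij => hinj (congrArg Subtype.val hij), hlim⟩
  · rintro ⟨γ, hinj, hlim⟩
    exact ⟨fun k => γ k, fun k => (γ k).2, Subtype.val_injective.comp hinj, hlim⟩

theorem isClosed_limitRoots : IsClosed G.limitRoots := by
  have hcluster : G.limitRoots = {x | ClusterPt x (map G.rootDirection cofinite)} :=
    Set.ext fun _ => G.mem_limitRoots_iff_mapClusterPt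
  exact hcluster ▸ isClosed_setOfPred_clusterPt

theorem continuous_rep_smul (w : W) : Continuous fun x : ℙ ℝ (S → ℝ) => G.rep w • x :=
  continuous_smul_projectivization (G.rep w).toLinearMap.continuous_of_finiteDimensional

theorem rep_smul_mem_limitRoots {x : ℙ ℝ (S → ℝ)} (w : W) (hx : x ∈ G.limitRoots) :
    G.rep w • x ∈ G.limitRoots := by
  obtain ⟨γ, hγ, hinj, hlim⟩ := hx
  refine ⟨fun k => G.rep w (γ k), fun k => ?_, (G.rep w).injective.comp hinj,
    ((G.continuous_rep_smul w).tendsto x).comp hlim⟩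
  obtain ⟨v, s, hs⟩ := hγ k
  exact ⟨w * v, s, by simp only [hs, rep_mul_apply]⟩

theorem mk_mem_limitRoots_of_contractsTo (hB : G.form.Nondegenerate) {w : ℕ → W} {u q : S → ℝ}
    (h : ContractsTo G.form (fun k => G.rep (w k)) atTop u q) (hu : u ≠ 0) (hq : q ≠ 0) :
    Projectivization.mk ℝ u hu ∈ G.limitRoots := by
  obtain ⟨s, hs⟩ := G.exists_form_simpleRoot_ne_zero hB hq
  let γ : ℕ → G.roots := fun k => ⟨G.rep (w k) (G.simpleRoot s), w k, s, rfl⟩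
  have hγ : Tendsto γ atTop cofinite := le_cofinite_iff_eventually_ne.2 fun α => by
    refine eventually_map.2 ?_
    filter_upwards [(h.tendsto_norm_apply hu hs).eventually_ne_atTop ‖α.1‖] with k hk hα
    exact hk (hα ▸ rfl)
  have hs0 : G.simpleRoot s ≠ 0 := by simp [simpleRoot]
  have hlim : Tendsto (G.rootDirection ∘ γ) atTop (𝓝 (Projectivization.mk ℝ u hu)) :=
    h.tendsto_smul_mk hu hs0 hs
  have hcluster : MapClusterPt (Projectivization.mk ℝ u hu) atTop (G.rootDirection ∘ γ) :=
    hlim.mapClusterPt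
  exact G.mem_limitRoots_iff_mapClusterPt.2 (hcluster.of_comp hγ)

theorem mk_mem_projLightCone_iff {v : S → ℝ} (hv : v ≠ 0) :
    Projectivization.mk ℝ v hv ∈ G.projLightCone ↔ G.form v v = 0 := by
  constructor
  · rintro ⟨u, hu, huu, h⟩
    obtain ⟨c, rfl⟩ := (Projectivization.mk_eq_mk_iff' ℝ _ _ _ _).1 h
    simp [huu]
  · exact fun h => ⟨v, hv, h, rfl⟩

theorem isClosed_projLightCone : IsClosed G.projLightCone := by
  rw [← isOpenQuotientMap_projectivization_mk'.isQuotientMap.isClosed_preimage]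
  have hcone : Projectivization.mk' ℝ ⁻¹' G.projLightCone =
      {v : {v : S → ℝ // v ≠ 0} | G.form v.1 v.1 = 0} :=
    Set.ext fun v => G.mk_mem_projLightCone_iff v.2
  have hform : Continuous fun v : S → ℝ => G.form v v :=
    continuous_iff_continuousAt.2 fun _ => tendsto_bilinForm_apply G.form tendsto_id tendsto_id
  exact hcone ▸ isClosed_eq (hform.comp continuous_subtype_val) continuous_const

theorem rep_smul_mem_projLightCone {x : ℙ ℝ (S → ℝ)} (w : W) (hx : x ∈ G.projLightCone) :
    G.rep w • x ∈ G.projLightCone := by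
  obtain ⟨v, hv, hvv, rfl⟩ := hx
  exact (G.mk_mem_projLightCone_iff _).2 ((G.form_rep_rep w v v).trans hvv)

variable {G}

namespace ArisesThrough

variable {w : ℕ → W} {x₀ x : ℙ ℝ (S → ℝ)}

theorem injective (h : G.ArisesThrough w x₀ x) : Function.Injective w :=
  Function.Injective.of_comp (f := fun v => G.rep v • x₀) h.1

theorem mem_of_isClosed (h : G.ArisesThrough w x₀ x) {Z : Set (ℙ ℝ (S → ℝ))} (hZ : IsClosed Z)
    (hsmul : ∀ v, G.rep v • x₀ ∈ Z) : x ∈ Z :=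
  hZ.mem_of_tendsto h.2 (Eventually.of_forall fun k => hsmul (w k))

end ArisesThrough

namespace IsLorentzian

variable (hG : G.IsLorentzian)
include hG

theorem isLorentzianForm : IsLorentzianForm G.form where
  isSymm := G.isSymm_form
  sigPos_add_one := hG.1.trans (Module.finrank_fintype_fun_eq_card ℝ).symm
  sigNeg_eq_one := hG.2

theorem projLightCone_nonempty : G.projLightCone.Nonempty := by
  obtain ⟨e, he⟩ := hG.isLorentzianForm.exists_neg
  obtain ⟨s, -⟩ := Function.ne_iff.1 (show e ≠ 0 by rintro rfl; simp at he)
  obtain ⟨v, hv, hvv⟩ := exists_ne_zero_quadraticForm_eq_zero (Q := G.form.toQuadraticMap)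
    (f := G.simpleRoot s) he (by simp [form_simpleRoot_self])
  exact ⟨_, v, hv, hvv, rfl⟩

theorem exists_subseq_contractsTo {w : ℕ → W} (hw : Function.Injective w) :
    ∃ φ : ℕ → ℕ, StrictMono φ ∧ ∃ u q, u ≠ 0 ∧ q ≠ 0 ∧
      ContractsTo G.form (fun k => G.rep (w (φ k))) atTop u q ∧
      ContractsTo G.form (fun k => G.rep (w (φ k))⁻¹) atTop q u := by
  have hB := hG.isLorentzianForm
  have hnorm := (G.tendsto_norm_rep_cofinite_atTop hB.nondegenerate).comp
    (Nat.cofinite_eq_atTop ▸ hw.tendsto_cofinite)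
  obtain ⟨φ, hφ, u, q, hu, hq, h⟩ :=
    hB.exists_subseq_contractsTo (fun k => G.form_rep_rep (w k)) hnorm
  have hinv := h.inv (fun k => G.form_rep_rep (w (φ k))) hB.nondegenerate hB.isSymm
  exact ⟨φ, hφ, u, q, hu, hq, h, by simpa only [Function.comp_apply, map_inv] using hinv⟩

theorem exists_attractor_repeller {w : ℕ → W} (hw : Function.Injective w) :
    ∃ p ∈ G.limitRoots ∩ G.projLightCone, ∃ r ∈ G.limitRoots,
      ∀ x₀ x, x₀ ≠ p → G.ArisesThrough w x₀ x → x ∈ G.projLightCone → x = r := by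
  have hB := hG.isLorentzianForm
  obtain ⟨φ, hφ, u, q, hu, hq, h, hinv⟩ := hG.exists_subseq_contractsTo hw
  have hqq := hinv.apply_self_eq_zero (fun k => G.form_rep_rep _) hB.nondegenerate hu
  refine ⟨_, ⟨G.mk_mem_limitRoots_of_contractsTo hB.nondegenerate hinv hq hu, q, hq, hqq, rfl⟩,
    _, G.mk_mem_limitRoots_of_contractsTo hB.nondegenerate h hu hq, ?_⟩
  rintro x₀ _ hx₀ hx ⟨a, ha, haa, rfl⟩
  exact h.eq_mk_of_tendsto_smul_mk (fun k => G.form_rep_rep _) hB hu hq hqq hx₀ ha haa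
    (hx.2.comp hφ.tendsto_atTop)

theorem mem_limitRoots_of_arisesThrough {w : ℕ → W} {x₀ x : ℙ ℝ (S → ℝ)}
    (h : G.ArisesThrough w x₀ x) (hx : x ∈ G.projLightCone) : x ∈ G.limitRoots := by
  obtain ⟨p, hp, r, hr, huniq⟩ := hG.exists_attractor_repeller h.injective
  obtain rfl | hx₀ := eq_or_ne x₀ p
  · exact h.mem_of_isClosed G.isClosed_limitRoots fun v => G.rep_smul_mem_limitRoots v hp.1
  · exact huniq x₀ x hx₀ h hx ▸ hr

theorem exists_forall_arisesThrough_eq (w : ℕ → W) :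
    ∃ p ∈ G.projLightCone, ∀ x₀ y₀ x y, x₀ ≠ p → y₀ ≠ p →
      G.ArisesThrough w x₀ x → x ∈ G.projLightCone →
      G.ArisesThrough w y₀ y → y ∈ G.projLightCone → x = y := by
  by_cases hw : Function.Injective w
  · obtain ⟨p, hp, r, -, huniq⟩ := hG.exists_attractor_repeller hw
    exact ⟨p, hp.2, fun x₀ y₀ x y hx₀ hy₀ h hx h' hy =>
      (huniq x₀ x hx₀ h hx).trans (huniq y₀ y hy₀ h' hy).symm⟩
  · obtain ⟨p, hp⟩ := hG.projLightCone_nonempty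
    exact ⟨p, hp, fun _ _ _ _ _ _ h => absurd h.injective hw⟩

end IsLorentzian

end GeometricCoxeterSystem

theorem mainTheorem3 {S W : Type*} [Fintype S] [DecidableEq S] [Group W]
    (G : GeometricCoxeterSystem S W) (hG : G.IsLorentzian) :
    -- a limit direction on the projective light cone, from any base point, is a limit root
    (∀ (w : ℕ → W) (x₀ x : ℙ ℝ (S → ℝ)),
      G.ArisesThrough w x₀ x → x ∈ G.projLightCone → x ∈ G.limitRoots) ∧
    -- every limit direction arising from a light-like base point is a limit root
    (∀ (w : ℕ → W) (x₀ x : ℙ ℝ (S → ℝ)),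
      x₀ ∈ G.projLightCone → G.ArisesThrough w x₀ x → x ∈ G.limitRoots) ∧
    -- light-like limits arising through the same sequence coincide, for all base points other
    -- than at most one light-like direction depending on the sequence
    (∀ w : ℕ → W, ∃ p ∈ G.projLightCone, ∀ x₀ y₀ x y : ℙ ℝ (S → ℝ),
      x₀ ≠ p → y₀ ≠ p →
      G.ArisesThrough w x₀ x → x ∈ G.projLightCone →
      G.ArisesThrough w y₀ y → y ∈ G.projLightCone → x = y) :=
  ⟨fun _ _ _ h hx => hG.mem_limitRoots_of_arisesThrough h hx,
    fun _ _ _ hx₀ h => hG.mem_limitRoots_of_arisesThrough h <|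
      h.mem_of_isClosed G.isClosed_projLightCone fun v => G.rep_smul_mem_projLightCone v hx₀,
    hG.exists_forall_arisesThrough_eq⟩
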